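/- Let $\mathbb K=\mathbb R$ or $\mathbb K=\mathbb C$, let $d\ge 3$ and $n_1,\dots,n_d\ge 2$ be integers, and let $\mathbb K^{\mathbf n}=\mathbb K^{n_1}\otimes\cdots\otimes\mathbb K^{n_d}$ be the space of tensors $T=(t_{i_1\dots i_d})$, with the Frobenius inner product $\langle T,T'\rangle=\sum_{i_1,\dots,i_d}\overline{t_{i_1\dots i_d}}\,t'_{i_1\dots i_d}$ and the Frobenius norm $\|T\|=\sqrt{\langle T,T\rangle}$. Let $$\|T\|_\infty=\max\bigl\{|\langle T,\mathbf x^1\otimes\cdots\otimes \mathbf x^d\rangle| : \mathbf x^j\in\mathbb K^{n_j},\ \|\mathbf x^j\|_2=1\bigr\}$$ be the spectral norm, let $$\mathcal A(\mathbb K^{\mathbf n})=\min_{0\ne T\in\mathbb K^{\mathbf n}}\frac{\|T\|_\infty}{\|T\|}$$ be the best rank-one approximation ratio, and put $M=\min_i\prod_{j\ne i}n_j$. The maximum and the minimum in these definitions are attained, and $$\frac1{\sqrt M}\le\mathcal A(\mathbb K^{\mathbf n})\le\frac{10\sqrt{d\ln d}}{\sqrt M}.$$ More precisely, $$\mathcal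 A(\mathbb K^{\mathbf n})\le 2\sqrt{3e}\,\sqrt{1+\frac{2}{\ln d}}\;\frac{\sqrt{d\ln d}}{\sqrt M}.$$ Moreover, let $\mathcal T$ be a Gaussian tensor in $\mathbb K^{\mathbf n}$, that is, a random tensor whose entries are independent standard Gaussians (with law $N(0,1)$ if $\mathbb K=\mathbb R$; with independent real and imaginary parts of law $N(0,\tfrac12)$ if $\mathbb K=\mathbb C$). Then the random variable $\|\mathcal T\|_\infty/\|\mathcal T\|$ (which is defined almost surely) is integrable and $$\mathbb E\,\frac{\|\mathcal T\|_\infty}{\|\mathcal T\|}\le 9\left(1+\frac1{\ln d}+\frac{2}{d+\sum_{j}n_j}\right)\frac{\sqrt{d\ln d}}{\sqrt M}.$$ -/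

import Mathlib

open MeasureTheory ProbabilityTheory

namespace BestRankOne

/-- The space of tensors of format `(n 0, …, n (d - 1))` over `𝕜`, as arrays of entries
indexed by `(i₁, …, i_d)`.  Its inner product and norm (from `EuclideanSpace`) are the Frobenius
inner product `∑ conj (t_i) * t'_i` and the Frobenius norm. -/
abbrev Tensor (𝕜 : Type*) {d : ℕ} (n : Fin d → ℕ) : Type _ :=
  EuclideanSpace 𝕜 ((j : Fin d) → Fin (n j))

/-- The tensor `x¹ ⊗ ⋯ ⊗ x^d`, with entries `x¹_{i₁} ⋯ x^d_{i_d}`. -/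
def pureTensor {𝕜 : Type*} [RCLike 𝕜] {d : ℕ} {n : Fin d → ℕ}
    (x : (j : Fin d) → EuclideanSpace 𝕜 (Fin (n j))) : Tensor 𝕜 n :=
  WithLp.toLp 2 (fun i => ∏ j, x j (i j))

/-- The set of the values `|⟨T, x¹ ⊗ ⋯ ⊗ x^d⟩|` with `x¹, …, x^d` unit vectors. -/
def spectralValues {𝕜 : Type*} [RCLike 𝕜] {d : ℕ} {n : Fin d → ℕ} (T : Tensor 𝕜 n) : Set ℝ :=
  {r | ∃ x : (j : Fin d) → EuclideanSpace 𝕜 (Fin (n j)),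
    (∀ j, ‖x j‖ = 1) ∧ r = ‖inner 𝕜 T (pureTensor x)‖}

/-- The spectral norm: the largest element of `spectralValues T`. -/
noncomputable def specNorm {𝕜 : Type*} [RCLike 𝕜] {d : ℕ} {n : Fin d → ℕ} (T : Tensor 𝕜 n) : ℝ :=
  sSup (spectralValues T)

/-- The set of the ratios of the spectral and the Frobenius norm of nonzero tensors. -/
def normRatios (𝕜 : Type*) [RCLike 𝕜] {d : ℕ} (n : Fin d → ℕ) : Set ℝ :=
  {r | ∃ T : Tensor 𝕜 n, T ≠ 0 ∧ r = specNorm T / ‖T‖}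

/-- The best rank-one approximation ratio: the least element of `normRatios 𝕜 n`. -/
noncomputable def approxRatio (𝕜 : Type*) [RCLike 𝕜] {d : ℕ} (n : Fin d → ℕ) : ℝ :=
  sInf (normRatios 𝕜 n)

/-- `min_i ∏_{j ≠ i} n_j`. -/
noncomputable def minCoprod {d : ℕ} (n : Fin d → ℕ) : ℕ :=
  ⨅ i : Fin d, ∏ j ∈ Finset.univ.erase i, n j

open Classical in
/-- The law of a standard Gaussian scalar: over the reals (where the imaginary unit `RCLike.I` is
`0`) it is `N(0, 1)`; over the complex numbers, real and imaginary parts are independent with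
law `N(0, 1/2)`. -/
noncomputable def gaussianLaw (𝕜 : Type*) [RCLike 𝕜] : Measure 𝕜 :=
  if (RCLike.I : 𝕜) = 0 then (gaussianReal 0 1).map (fun x : ℝ => (x : 𝕜))
  else ((gaussianReal 0 (1 / 2)).prod (gaussianReal 0 (1 / 2))).map
    (fun p : ℝ × ℝ => (p.1 : 𝕜) + (p.2 : 𝕜) * RCLike.I)

theorem gaussianLaw_real : gaussianLaw ℝ = gaussianReal 0 1 := by
  unfold gaussianLaw
  rw [if_pos (by simp)]
  exact Measure.map_id

theorem gaussianLaw_complex : gaussianLaw ℂ =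
    ((gaussianReal 0 (1 / 2)).prod (gaussianReal 0 (1 / 2))).map
      (fun p : ℝ × ℝ => (p.1 : ℂ) + (p.2 : ℂ) * Complex.I) := by
  unfold gaussianLaw
  rw [if_neg (by simp)]
  rfl

/-- A random tensor is Gaussian if its entries are independent standard (real or complex)
Gaussians. -/
structure IsGaussianTensor {𝕜 : Type*} [RCLike 𝕜] {d : ℕ} {n : Fin d → ℕ}
    {Ω : Type*} [MeasurableSpace Ω] (P : Measure Ω) (T : Ω → Tensor 𝕜 n) : Prop where
  hasLaw : ∀ i, HasLaw (fun ω => T ω i) (gaussianLaw 𝕜) P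
  indep : iIndepFun (fun i ω => T ω i) P

end BestRankOne

open scoped Pointwise

namespace BestRankOne

/-! ### Nets on spheres by volume packing. -/

section Net

variable {E : Type*} [NormedAddCommGroup E] [NormedSpace ℝ E] [FiniteDimensional ℝ E]

/-! The lower bound is pigeonhole: fixing all indices but the `i`-th cuts `T` into `∏ j ≠ i, n j`
fibres. The norm of each fibre is the value of `T` on a rank-one unit tensor (normalized fibre times
basis vectors), hence at most the spectral norm. Summing squares and minimizing over `i` gives `1 /
√M` (`norm_sq_le_specNorm`).

The upper bound is probabilistic: the minimum ratio is at most the mean ratio of a Gaussian tensor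
`T`. By weighted AM-GM (`integral_ratio_le`) it suffices to bound two moments. For `E ‖T‖_∞²`,
multilinearity replaces the product of spheres by a product of `1 / (2d)`-nets at the cost of a
factor 2. The product net has at most `B = (1 + 4d)^(2 ∑ n_j)` points, and at each of them `exp (3/8
|⟨T, y⟩|²)` has mean at most 2. So the second moment is `O(log B)`, that is `O(d m log d)` with `m =
max n_j` (`integral_specNorm_sq_le`). For `E ‖T‖⁻²`, writing `1 / y` as the Laplace integral of `exp
(-s y)` and using independence of the `N = ∏ n_j` entries gives at most `1 / (N - 2)`
(`integral_inv_norm_sq_le`). Since `N = M m`, the product of the two bounds is `O(d log d / M)`; the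
constants are checked in `second_moment_bound_le`. -/

theorem card_le_of_separated_of_norm_le_one (s : Finset E) {ε : ℝ} (hε : 0 < ε)
    (hs : ∀ c ∈ s, ‖c‖ ≤ 1) (h : ∀ c ∈ s, ∀ d ∈ s, c ≠ d → ε ≤ ‖c - d‖) :
    (s.card : ℝ) ≤ (1 + 2 / ε) ^ Module.finrank ℝ E := by
  borelize E
  let μ : Measure E := Measure.addHaar
  have hδ : 0 < ε / 2 := by positivity
  have hρ : 0 < 1 + ε / 2 := by positivity
  have D : Set.Pairwise (s : Set E)
      (Function.onFun Disjoint fun c => Metric.ball (c : E) (ε / 2)) := by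
    rintro c hc d hd hcd
    apply Metric.ball_disjoint_ball
    rw [dist_eq_norm, add_halves]
    exact h c hc d hd hcd
  -- The disjoint balls of radius `ε / 2` fit in one ball of radius `1 + ε / 2`; comparing Haar
  -- volumes gives the bound.
  have hsub : (⋃ c ∈ s, Metric.ball c (ε / 2)) ⊆ Metric.ball (0 : E) (1 + ε / 2) := by
    refine Set.iUnion₂_subset fun x hx => Metric.ball_subset_ball' ?_
    rw [dist_zero_right]
    linarith [hs x hx]
  have I : (s.card : ENNReal) * ENNReal.ofReal ((ε / 2) ^ Module.finrank ℝ E) *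
      μ (Metric.ball 0 1) ≤
      ENNReal.ofReal ((1 + ε / 2) ^ Module.finrank ℝ E) * μ (Metric.ball 0 1) :=
    calc
      _ = μ (⋃ c ∈ s, Metric.ball c (ε / 2)) := by
        rw [measure_biUnion_finset D fun c _ => Metric.isOpen_ball.measurableSet]
        simp only [μ.addHaar_ball_of_pos _ hδ, Finset.sum_const, nsmul_eq_mul, mul_assoc]
      _ ≤ μ (Metric.ball (0 : E) (1 + ε / 2)) := measure_mono hsub
      _ = _ := by simp only [μ.addHaar_ball_of_pos _ hρ]
  have J := (ENNReal.mul_le_mul_iff_left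
    (Metric.measure_ball_pos μ (0 : E) zero_lt_one).ne' measure_ball_lt_top.ne).1 I
  have K := ENNReal.toReal_le_of_le_ofReal (by positivity) J
  rw [ENNReal.toReal_mul, ENNReal.toReal_natCast, ENNReal.toReal_ofReal (by positivity),
    ← le_div_iff₀ (by positivity), ← div_pow] at K
  rwa [show (1 + ε / 2) / (ε / 2) = 1 + 2 / ε by field_simp; ring] at K

/-- An `ε`-separated subset of the sphere of maximal cardinality is a net, since a point far from
all of it could be added. The packing bound ensures that the maximum exists. -/
theorem exists_finset_sphere_net {ε : ℝ} (hε : 0 < ε) :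
    ∃ s : Finset E, (∀ c ∈ s, ‖c‖ = 1) ∧ (s.card : ℝ) ≤ (1 + 2 / ε) ^ Module.finrank ℝ E ∧
      ∀ x : E, ‖x‖ = 1 → ∃ y ∈ s, ‖x - y‖ < ε := by
  classical
  let S : Set ℕ := {k | ∃ s : Finset E, (∀ c ∈ s, ‖c‖ = 1) ∧
    (∀ c ∈ s, ∀ d ∈ s, c ≠ d → ε ≤ ‖c - d‖) ∧ s.card = k}
  have hne : S.Nonempty := ⟨0, ∅, by simp⟩
  have hbdd : BddAbove S := by
    refine ⟨⌊(1 + 2 / ε) ^ Module.finrank ℝ E⌋₊, ?_⟩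
    rintro k ⟨s, h1, h2, rfl⟩
    exact Nat.le_floor (card_le_of_separated_of_norm_le_one s hε (fun c hc => (h1 c hc).le) h2)
  obtain ⟨s, h1, h2, h3⟩ := Nat.sSup_mem hne hbdd
  refine ⟨s, h1, card_le_of_separated_of_norm_le_one s hε (fun c hc => (h1 c hc).le) h2, ?_⟩
  intro x hx
  by_contra! hcon
  have hxs : x ∉ s := fun hxs => by
    have := hcon x hxs
    simp at this
    linarith
  have : (insert x s).card ∈ S := by
    refine ⟨insert x s, ?_, ?_, rfl⟩
    · simpa using ⟨hx, h1⟩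
    · intro c hc d hd hcd
      rcases Finset.mem_insert.1 hc with hc' | hc' <;>
        rcases Finset.mem_insert.1 hd with hd' | hd'
      · exact absurd (hc'.trans hd'.symm) hcd
      · exact hc' ▸ hcon d hd'
      · rw [norm_sub_rev]; exact hd' ▸ hcon c hc'
      · exact h2 c hc' d hd' hcd
  have := le_csSup hbdd this
  rw [Finset.card_insert_of_notMem hxs, ← h3] at this
  omega

end Net

/-! ### The spectral norm: attainment, discretization, comparison with the Frobenius norm. -/

section Spectral

variable {𝕜 : Type*} [RCLike 𝕜] {d : ℕ} {n : Fin d → ℕ}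

theorem norm_pureTensor (x : (j : Fin d) → EuclideanSpace 𝕜 (Fin (n j))) :
    ‖pureTensor x‖ = ∏ j, ‖x j‖ := by
  rw [← sq_eq_sq₀ (norm_nonneg _) (by positivity), EuclideanSpace.norm_sq_eq, ← Finset.prod_pow]
  simp_rw [EuclideanSpace.norm_sq_eq]
  rw [Finset.prod_univ_sum]
  simp [pureTensor, Finset.prod_pow]

/-- The multilinear form `x ↦ ⟨T, x¹ ⊗ ⋯ ⊗ x^d⟩`. -/
noncomputable def innerPure (T : Tensor 𝕜 n) :
    MultilinearMap 𝕜 (fun j => EuclideanSpace 𝕜 (Fin (n j))) 𝕜 :=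
  ∑ i, starRingEnd 𝕜 (T i) • (MultilinearMap.mkPiAlgebra 𝕜 (Fin d) 𝕜).compLinearMap
    (fun j => (EuclideanSpace.proj (i j) : EuclideanSpace 𝕜 (Fin (n j)) →L[𝕜] 𝕜).toLinearMap)

theorem innerPure_apply (T : Tensor 𝕜 n) (x : (j : Fin d) → EuclideanSpace 𝕜 (Fin (n j))) :
    innerPure T x = inner 𝕜 T (pureTensor x) := by
  simp [innerPure, pureTensor, PiLp.inner_apply, mul_comm]

theorem norm_inner_pureTensor_le (T : Tensor 𝕜 n)
    {x : (j : Fin d) → EuclideanSpace 𝕜 (Fin (n j))} (hx : ∀ j, ‖x j‖ = 1) :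
    ‖inner 𝕜 T (pureTensor x)‖ ≤ ‖T‖ := by
  simpa [norm_pureTensor, hx] using norm_inner_le_norm (𝕜 := 𝕜) T (pureTensor x)

theorem continuous_pureTensor :
    Continuous (pureTensor : ((j : Fin d) → EuclideanSpace 𝕜 (Fin (n j))) → Tensor 𝕜 n) := by
  unfold pureTensor
  fun_prop

theorem isCompact_spectralValues (T : Tensor 𝕜 n) : IsCompact (spectralValues T) := by
  have : spectralValues T = (fun x => ‖inner 𝕜 T (pureTensor x)‖) ''
      (Set.univ.pi fun j : Fin d => Metric.sphere (0 : EuclideanSpace 𝕜 (Fin (n j))) 1) := by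
    ext r
    simp [spectralValues, Set.mem_pi, eq_comm]
  rw [this]
  refine (isCompact_univ_pi fun j => isCompact_sphere _ _).image ?_
  exact (continuous_const.inner continuous_pureTensor).norm

theorem spectralValues_nonempty (hn : ∀ j, 2 ≤ n j) (T : Tensor 𝕜 n) :
    (spectralValues T).Nonempty :=
  ⟨_, fun j => EuclideanSpace.single ⟨0, by have := hn j; omega⟩ 1, by simp, rfl⟩

theorem isGreatest_specNorm (hn : ∀ j, 2 ≤ n j) (T : Tensor 𝕜 n) :
    IsGreatest (spectralValues T) (specNorm T) :=
  (isCompact_spectralValues T).isGreatest_sSup (spectralValues_nonempty hn T)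

theorem specNorm_nonneg (T : Tensor 𝕜 n) : 0 ≤ specNorm T := by
  apply Real.sSup_nonneg
  rintro _ ⟨x, -, rfl⟩
  positivity

theorem norm_inner_pureTensor_le_specNorm (T : Tensor 𝕜 n)
    {x : (j : Fin d) → EuclideanSpace 𝕜 (Fin (n j))} (hx : ∀ j, ‖x j‖ = 1) :
    ‖inner 𝕜 T (pureTensor x)‖ ≤ specNorm T :=
  le_csSup (isCompact_spectralValues T).bddAbove ⟨x, hx, rfl⟩

theorem norm_innerPure_le (T : Tensor 𝕜 n) (x : (j : Fin d) → EuclideanSpace 𝕜 (Fin (n j))) :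
    ‖innerPure T x‖ ≤ specNorm T * ∏ j, ‖x j‖ := by
  by_cases h : ∀ j, x j ≠ 0
  · have key := norm_inner_pureTensor_le_specNorm T
      (x := fun j => ((‖x j‖⁻¹ : ℝ) : 𝕜) • x j) (fun j => by
        simp [norm_smul, h j])
    rw [← innerPure_apply, MultilinearMap.map_smul_univ, norm_smul, norm_prod] at key
    simp only [RCLike.norm_ofReal, abs_inv, abs_norm, Finset.prod_inv_distrib] at key
    rwa [inv_mul_eq_div, div_le_iff₀] at key
    exact Finset.prod_pos fun j _ => norm_pos_iff.2 (h j)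
  · push Not at h
    obtain ⟨j, hj⟩ := h
    rw [(innerPure T).map_coord_zero j hj, norm_zero]
    exact mul_nonneg (specNorm_nonneg T) (by positivity)

theorem specNorm_le_norm (hn : ∀ j, 2 ≤ n j) (T : Tensor 𝕜 n) : specNorm T ≤ ‖T‖ := by
  obtain ⟨x, hx, h⟩ := (isGreatest_specNorm hn T).1
  rw [h]
  exact norm_inner_pureTensor_le T hx

theorem specNorm_le_add (hn : ∀ j, 2 ≤ n j) (S T : Tensor 𝕜 n) :
    specNorm S ≤ specNorm T + ‖S - T‖ := by
  obtain ⟨x, hx, h⟩ := (isGreatest_specNorm hn S).1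
  rw [h]
  calc ‖inner 𝕜 S (pureTensor x)‖
      = ‖inner 𝕜 T (pureTensor x) + inner 𝕜 (S - T) (pureTensor x)‖ := by
        rw [← inner_add_left]; simp
    _ ≤ _ := (norm_add_le _ _).trans (add_le_add (norm_inner_pureTensor_le_specNorm T hx)
        (norm_inner_pureTensor_le _ hx))

theorem continuous_specNorm (hn : ∀ j, 2 ≤ n j) :
    Continuous (specNorm : Tensor 𝕜 n → ℝ) := by
  refine LipschitzWith.continuous (K := 1) (LipschitzWith.of_dist_le_mul fun S T => ?_)
  rw [Real.dist_eq, dist_eq_norm, NNReal.coe_one, one_mul, abs_le]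
  have h1 := specNorm_le_add hn S T
  have h2 := specNorm_le_add hn T S
  rw [norm_sub_rev] at h2
  constructor <;> linarith

theorem specNorm_smul (c : 𝕜) (T : Tensor 𝕜 n) : specNorm (c • T) = ‖c‖ * specNorm T := by
  have : spectralValues (c • T) = ‖c‖ • spectralValues T := by
    ext r
    simp only [spectralValues, Set.mem_smul_set, Set.mem_ofPred_eq, inner_smul_left, norm_mul,
      RCLike.norm_conj, smul_eq_mul]
    constructor
    · rintro ⟨x, hx, rfl⟩
      exact ⟨_, ⟨x, hx, rfl⟩, rfl⟩
    · rintro ⟨_, ⟨x, hx, rfl⟩, rfl⟩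
      exact ⟨x, hx, rfl⟩
  rw [specNorm, this, Real.sSup_smul_of_nonneg (norm_nonneg c), smul_eq_mul, specNorm]

/-- The ratio is invariant under scaling, so it suffices to minimize the continuous spectral norm
over the compact Frobenius unit sphere. -/
theorem isLeast_approxRatio (hn : ∀ j, 2 ≤ n j) :
    IsLeast (normRatios 𝕜 n) (approxRatio 𝕜 n) := by
  have heq : normRatios 𝕜 n = specNorm '' Metric.sphere (0 : Tensor 𝕜 n) 1 := by
    ext r
    constructor
    · rintro ⟨T, hT, rfl⟩
      refine ⟨((‖T‖⁻¹ : ℝ) : 𝕜) • T, by simp [norm_smul, hT], ?_⟩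
      rw [specNorm_smul]
      simp [inv_mul_eq_div]
    · rintro ⟨T, hT, rfl⟩
      have hT : ‖T‖ = 1 := by simpa using hT
      exact ⟨T, by rw [← norm_ne_zero_iff, hT]; simp, by simp [hT]⟩
  have hne : (Metric.sphere (0 : Tensor 𝕜 n) 1).Nonempty :=
    ⟨EuclideanSpace.single (fun j => ⟨0, by have := hn j; omega⟩) 1, by simp⟩
  rw [approxRatio, heq]
  exact ((isCompact_sphere _ _).image (continuous_specNorm hn)).isLeast_sInf (hne.image _)

/-- The spectral norm is at most twice the maximum over a product of `1 / (2 d)`-nets. -/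
theorem exists_net_specNorm_le (hd : 0 < d) (hn : ∀ j, 2 ≤ n j)
    (s : (j : Fin d) → Finset (EuclideanSpace 𝕜 (Fin (n j)))) (hs : ∀ j, ∀ c ∈ s j, ‖c‖ = 1)
    (hnet : ∀ j, ∀ x : EuclideanSpace 𝕜 (Fin (n j)), ‖x‖ = 1 →
      ∃ y ∈ s j, ‖x - y‖ < 1 / (2 * d)) (T : Tensor 𝕜 n) :
    ∃ y ∈ Fintype.piFinset s, specNorm T ≤ 2 * ‖inner 𝕜 T (pureTensor y)‖ := by
  obtain ⟨x, hx, h⟩ := (isGreatest_specNorm hn T).1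
  choose y hys hxy using fun j => hnet j (x j) (hx j)
  refine ⟨y, by simpa using hys, ?_⟩
  have hd' : (0 : ℝ) < d := by exact_mod_cast hd
  have hy : ∀ j, ‖y j‖ = 1 := fun j => hs j _ (hys j)
  -- Changing one factor at a time from a maximizer `x` to its net approximation `y`, each of the
  -- `d` changes costs at most `specNorm T / (2d)`. The total loss is at most half of the maximum.
  have key := (innerPure T).norm_image_sub_le_of_bound' (specNorm_nonneg T)
    (norm_innerPure_le T) x y
  have hsum : ∑ i, ∏ j, (if j = i then ‖x i - y i‖ else max ‖x j‖ ‖y j‖) ≤ 1 / 2 := by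
    calc _ ≤ ∑ i : Fin d, (1 / (2 * d) : ℝ) := by
          refine Finset.sum_le_sum fun i _ => ?_
          rw [Finset.prod_eq_single i]
          · simpa using (hxy i).le
          · intro j _ hj
            simp [hj, hx, hy]
          · simp
      _ = 1 / 2 := by
          simp
          field_simp
  have h2 := norm_sub_norm_le (innerPure T x) (innerPure T y)
  rw [innerPure_apply, innerPure_apply, ← h] at h2
  rw [innerPure_apply, innerPure_apply] at key
  have := mul_le_mul_of_nonneg_left hsum (specNorm_nonneg T)
  linarith

theorem norm_sq_le_specNorm (i₀ : Fin d) (T : Tensor 𝕜 n) :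
    ‖T‖ ^ 2 ≤ (∏ j ∈ Finset.univ.erase i₀, n j : ℕ) * specNorm T ^ 2 := by
  classical
  let e := Equiv.piSplitAt i₀ (fun j => Fin (n j))
  -- For a choice `k` of the other indices: the fibre of `T` over `k` in direction `i₀`, basis
  -- vectors elsewhere. The inner product conjugates `T`, so pairing with `pureTensor (x k)` gives
  -- the squared norm of the fibre.
  let x : ((j : { j // j ≠ i₀ }) → Fin (n j)) → (j : Fin d) → EuclideanSpace 𝕜 (Fin (n j)) :=
    fun k j => if h : j = i₀ then WithLp.toLp 2 fun a => T (e.symm (h ▸ a, k))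
      else EuclideanSpace.single (k ⟨j, h⟩) 1
  have hx : ∀ k, x k i₀ = WithLp.toLp 2 fun a => T (e.symm (a, k)) := fun k => by simp [x]
  have hslice : ∀ k, ‖x k i₀‖ ≤ specNorm T := by
    intro k
    have h1 : inner 𝕜 T (pureTensor (x k)) = ((‖x k i₀‖ ^ 2 : ℝ) : 𝕜) := by
      rw [PiLp.inner_apply, ← e.symm.sum_comp, Fintype.sum_prod_type_right]
      rw [Finset.sum_eq_single k]
      · rw [EuclideanSpace.norm_sq_eq, hx, RCLike.ofReal_sum]
        refine Finset.sum_congr rfl fun a _ => ?_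
        have : pureTensor (x k) (e.symm (a, k)) = T (e.symm (a, k)) := by
          simp only [pureTensor]
          rw [Finset.prod_eq_single i₀]
          · rw [hx]
            simp [e, Equiv.piSplitAt]
          · intro j _ hj
            simp [x, hj, e, Equiv.piSplitAt]
          · simp
        rw [this]
        simp
      · intro k' _ hk
        refine Finset.sum_eq_zero fun a _ => ?_
        obtain ⟨j, hj⟩ := Function.ne_iff.1 hk
        have : pureTensor (x k) (e.symm (a, k')) = 0 := by
          simp only [pureTensor]
          refine Finset.prod_eq_zero (Finset.mem_univ (j : Fin d)) ?_
          simp [x, j.2, e, Equiv.piSplitAt, hj]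
        rw [this, inner_zero_right]
      · simp
    have h2 := norm_innerPure_le T (x k)
    rw [innerPure_apply, h1, Finset.prod_eq_single i₀] at h2
    · rw [RCLike.norm_ofReal, abs_of_nonneg (by positivity), sq] at h2
      by_cases h0 : ‖x k i₀‖ = 0
      · rw [h0]; exact specNorm_nonneg T
      · exact le_of_mul_le_mul_right h2 ((norm_nonneg _).lt_of_ne' h0)
    · intro j _ hj
      simp [x, hj]
    · simp
  have hT : ‖T‖ ^ 2 = ∑ k, ‖x k i₀‖ ^ 2 := by
    rw [EuclideanSpace.norm_sq_eq, ← e.symm.sum_comp, Fintype.sum_prod_type_right]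
    refine Finset.sum_congr rfl fun k _ => ?_
    rw [hx, EuclideanSpace.norm_sq_eq]
  have hcard : Fintype.card ((j : { j // j ≠ i₀ }) → Fin (n j)) =
      ∏ j ∈ Finset.univ.erase i₀, n j := by
    rw [Fintype.card_pi]
    simp only [Fintype.card_fin]
    rw [← Finset.prod_subtype (Finset.univ.erase i₀) (by simp) (fun j => n j)]
  rw [hT, ← hcard]
  calc _ ≤ ∑ _k : (j : { j // j ≠ i₀ }) → Fin (n j), specNorm T ^ 2 :=
        Finset.sum_le_sum fun k _ => pow_le_pow_left₀ (norm_nonneg _) (hslice k) 2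
    _ = _ := by simp

end Spectral

/-! ### The minimal coproduct and the lower bound. -/

section Coprod

variable {d : ℕ}

theorem exists_eq_minCoprod (hd : 0 < d) (n : Fin d → ℕ) :
    ∃ i, minCoprod n = ∏ j ∈ Finset.univ.erase i, n j := by
  have : Nonempty (Fin d) := ⟨⟨0, hd⟩⟩
  obtain ⟨i, hi⟩ := exists_eq_ciInf_of_finite (f := fun i => ∏ j ∈ Finset.univ.erase i, n j)
  exact ⟨i, hi.symm⟩

theorem minCoprod_le (n : Fin d → ℕ) (i : Fin d) :
    minCoprod n ≤ ∏ j ∈ Finset.univ.erase i, n j :=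
  ciInf_le (OrderBot.bddBelow _) i

theorem one_div_sqrt_minCoprod_le {𝕜 : Type*} [RCLike 𝕜] (hd : 0 < d) {n : Fin d → ℕ}
    (hn : ∀ j, 2 ≤ n j) : 1 / √(minCoprod n : ℝ) ≤ approxRatio 𝕜 n := by
  obtain ⟨T, hT, h⟩ := (isLeast_approxRatio (𝕜 := 𝕜) hn).1
  obtain ⟨i, hi⟩ := exists_eq_minCoprod hd n
  have hM : (0 : ℝ) < minCoprod n := by
    rw [hi]
    exact_mod_cast Finset.prod_pos fun j _ => by have := hn j; omega
  have h1 := norm_sq_le_specNorm i T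
  rw [← hi] at h1
  rw [h, div_le_div_iff₀ (by positivity) (norm_pos_iff.2 hT), one_mul]
  have h2 := specNorm_nonneg T
  apply le_of_sq_le_sq _ (by positivity)
  rw [mul_pow, Real.sq_sqrt hM.le]
  linarith

/-- Omitting the largest dimension minimizes the product of the others; `m` is that dimension. -/
theorem exists_minCoprod_mul_eq (hd : 0 < d) {n : Fin d → ℕ} (hn : ∀ j, 2 ≤ n j) :
    ∃ m, 2 ≤ m ∧ (∀ j, n j ≤ m) ∧ minCoprod n * m = ∏ j, n j := by
  obtain ⟨i, hi⟩ := exists_eq_minCoprod hd n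
  have h := fun j => Finset.prod_erase_mul Finset.univ n (Finset.mem_univ j)
  have hM : 0 < minCoprod n := by
    rw [hi]
    exact Finset.prod_pos fun j _ => by have := hn j; omega
  refine ⟨n i, hn i, fun j => ?_, by rw [hi, h]⟩
  refine Nat.le_of_mul_le_mul_left (?_ : minCoprod n * n j ≤ minCoprod n * n i) hM
  calc minCoprod n * n j ≤ _ := Nat.mul_le_mul_right _ (minCoprod_le n j)
    _ = minCoprod n * n i := by rw [h j, hi, h i]

end Coprod

/-! ### Scalar Gaussian integrals. -/

section Gaussian

open scoped NNReal ENNReal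

theorem lintegral_exp_mul_sq_gaussianReal {v : ℝ≥0} (hv : v ≠ 0) {c : ℝ} (hc : 2 * c * v < 1) :
    ∫⁻ x, ENNReal.ofReal (Real.exp (c * x ^ 2)) ∂gaussianReal 0 v =
      ENNReal.ofReal (√(1 - 2 * c * v))⁻¹ := by
  have hv' : (0 : ℝ) < v := by positivity
  have hb : 0 < 1 / (2 * v) - c := by
    rw [sub_pos, lt_div_iff₀ (by positivity)]
    linarith
  have hfun : ∀ x : ℝ, gaussianPDF 0 v x * ENNReal.ofReal (Real.exp (c * x ^ 2)) =
      ENNReal.ofReal ((√(2 * Real.pi * v))⁻¹ * Real.exp (-(1 / (2 * v) - c) * x ^ 2)) := by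
    intro x
    rw [gaussianPDF, gaussianPDFReal, ← ENNReal.ofReal_mul (by positivity), mul_assoc,
      ← Real.exp_add]
    congr 3
    field_simp
    ring
  rw [gaussianReal_of_var_ne_zero _ hv,
    lintegral_withDensity_eq_lintegral_mul _ (measurable_gaussianPDF 0 v) (by fun_prop)]
  simp only [Pi.mul_apply, hfun]
  rw [← ofReal_integral_eq_lintegral_ofReal ((integrable_exp_neg_mul_sq hb).const_mul _)
    (Filter.Eventually.of_forall fun x => by positivity), integral_const_mul, integral_gaussian]
  congr 1
  rw [← Real.sqrt_inv, ← Real.sqrt_inv, ← Real.sqrt_mul (by positivity)]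
  congr 1
  have : 0 < 1 - 2 * c * v := by linarith
  have := Real.pi_pos
  rw [show 1 / (2 * v) - c = (1 - 2 * c * v) / (2 * v) by field_simp]
  field_simp

theorem map_sum_gaussianReal {Ω ι : Type*} [MeasurableSpace Ω] {P : Measure Ω} [Fintype ι]
    {X : ι → Ω → ℝ} {v : ι → ℝ≥0} (hX : ∀ i, HasLaw (X i) (gaussianReal 0 (v i)) P)
    (h : iIndepFun X P) : P.map (∑ i, X i) = gaussianReal 0 (∑ i, v i) := by
  have := h.isProbabilityMeasure
  refine Measure.ext_of_charFun ?_
  rw [h.charFun_map_sum_eq_prod (fun i => (hX i).aemeasurable)]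
  ext t
  simp only [Finset.prod_apply, (hX _).map_eq, charFun_gaussianReal, ← Complex.exp_sum]
  congr 1
  push_cast
  simp [Finset.sum_mul, Finset.sum_div]

variable {𝕜 : Type*} [RCLike 𝕜]

instance isProbabilityMeasure_gaussianLaw : IsProbabilityMeasure (gaussianLaw 𝕜) := by
  unfold gaussianLaw
  split_ifs
  · exact Measure.isProbabilityMeasure_map (by fun_prop)
  · exact Measure.isProbabilityMeasure_map (by fun_prop)

variable (𝕜) in
open Classical in
/-- The variance of the real part of a standard Gaussian scalar. -/
noncomputable def realPartVariance : ℝ≥0 := if (RCLike.I : 𝕜) = 0 then 1 else 1 / 2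

theorem map_re_inner_gaussianLaw (a : 𝕜) :
    (gaussianLaw 𝕜).map (fun g => RCLike.re (inner 𝕜 g a)) =
      gaussianReal 0 (realPartVariance 𝕜 * ‖a‖₊ ^ 2) := by
  have hmeas : Measurable (fun g : 𝕜 => RCLike.re (inner 𝕜 g a)) := by fun_prop
  have hnorm : ‖a‖ ^ 2 = RCLike.re a ^ 2 + RCLike.im a ^ 2 := by
    rw [RCLike.norm_sq_eq_def]; ring
  unfold gaussianLaw realPartVariance
  split_ifs with hI
  · rw [Measure.map_map hmeas (by fun_prop)]
    have : (fun g : 𝕜 => RCLike.re (inner 𝕜 g a)) ∘ (fun x : ℝ => (x : 𝕜)) =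
        fun x => RCLike.re a * x := by
      ext x; simp [mul_comm]
    rw [this, gaussianReal_map_const_mul]
    congr 1
    · simp
    · ext
      simp [hnorm, RCLike.im_eq_zero hI]
  · have hI' := RCLike.I_eq_zero_or_im_I_eq_one.resolve_left hI
    rw [Measure.map_map hmeas (by fun_prop)]
    have : (fun g : 𝕜 => RCLike.re (inner 𝕜 g a)) ∘
        (fun p : ℝ × ℝ => (p.1 : 𝕜) + (p.2 : 𝕜) * RCLike.I) =
        (fun p => RCLike.re a * p.1) + (fun p => RCLike.im a * p.2) := by
      ext p; simp [hI', mul_comm]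
    rw [this, gaussianReal_add_gaussianReal_of_indepFun (m₁ := 0) (m₂ := 0)
      (v₁ := NNReal.mk (RCLike.re a ^ 2) (sq_nonneg _) * (1 / 2))
      (v₂ := NNReal.mk (RCLike.im a ^ 2) (sq_nonneg _) * (1 / 2))]
    · congr 1
      · simp
      · ext
        simp [hnorm]
        ring
    · exact indepFun_prod (X := fun x : ℝ => RCLike.re a * x) (Y := fun x : ℝ => RCLike.im a * x)
        (by fun_prop) (by fun_prop)
    · have := gaussianReal_map_const_mul (μ := 0) (v := 1 / 2) (RCLike.re a)
      rw [mul_zero] at this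
      rw [← this, ← Function.comp_def (fun x : ℝ => RCLike.re a * x) Prod.fst,
        ← Measure.map_map (by fun_prop) (by fun_prop), Measure.map_fst_prod]
      simp
    · have := gaussianReal_map_const_mul (μ := 0) (v := 1 / 2) (RCLike.im a)
      rw [mul_zero] at this
      rw [← this, ← Function.comp_def (fun x : ℝ => RCLike.im a * x) Prod.snd,
        ← Measure.map_map (by fun_prop) (by fun_prop), Measure.map_snd_prod]
      simp

/-- Equality holds over the reals. Over the complex numbers the integral is `(1 + s)⁻¹`, and `(1 +
s)² ≥ 1 + 2s` yields the same bound, so both fields can be treated together. -/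
theorem lintegral_exp_neg_mul_sq_gaussianLaw_le {s : ℝ} (hs : 0 ≤ s) :
    ∫⁻ g, ENNReal.ofReal (Real.exp (-s * ‖g‖ ^ 2)) ∂gaussianLaw 𝕜 ≤
      ENNReal.ofReal (√(1 + 2 * s))⁻¹ := by
  unfold gaussianLaw
  split_ifs with hI
  · rw [lintegral_map (by fun_prop) (by fun_prop)]
    simp only [RCLike.norm_ofReal, sq_abs]
    rw [lintegral_exp_mul_sq_gaussianReal one_ne_zero (by push_cast; linarith)]
    apply le_of_eq
    congr 4
    push_cast
    ring
  · have hI' := RCLike.I_eq_zero_or_im_I_eq_one.resolve_left hI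
    rw [lintegral_map (by fun_prop) (by fun_prop)]
    have hfun : ∀ p : ℝ × ℝ, ENNReal.ofReal (Real.exp (-s * ‖(p.1 : 𝕜) + p.2 * RCLike.I‖ ^ 2)) =
        ENNReal.ofReal (Real.exp (-s * p.1 ^ 2)) * ENNReal.ofReal (Real.exp (-s * p.2 ^ 2)) := by
      intro p
      rw [← ENNReal.ofReal_mul (by positivity), ← Real.exp_add, RCLike.norm_sq_eq_def]
      simp [hI']
      ring_nf
    simp only [hfun]
    rw [lintegral_prod_mul (f := fun x : ℝ => ENNReal.ofReal (Real.exp (-s * x ^ 2)))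
        (g := fun x : ℝ => ENNReal.ofReal (Real.exp (-s * x ^ 2))) (by fun_prop) (by fun_prop),
      lintegral_exp_mul_sq_gaussianReal (by simp) (by push_cast; linarith),
      ← ENNReal.ofReal_mul (by positivity)]
    apply ENNReal.ofReal_le_ofReal
    rw [← mul_inv, Real.mul_self_sqrt (by push_cast; linarith)]
    gcongr
    rw [Real.sqrt_le_iff]
    push_cast
    constructor <;> nlinarith

end Gaussian

/-! ### Exponential moments and the inverse second moment of a Gaussian tensor. -/

section GaussianTensor

open scoped NNReal ENNReal

variable {𝕜 : Type*} [RCLike 𝕜] {d : ℕ} {n : Fin d → ℕ} {Ω : Type*} [MeasurableSpace Ω]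
  {P : Measure Ω} {T : Ω → Tensor 𝕜 n}

theorem IsGaussianTensor.aemeasurable (hT : IsGaussianTensor P T) : AEMeasurable T P := by
  have h : AEMeasurable (fun ω i => T ω i) P :=
    aemeasurable_pi_lambda _ fun i => (hT.hasLaw i).aemeasurable
  exact (WithLp.measurable_toLp 2 _).comp_aemeasurable h

theorem IsGaussianTensor.map_re_inner (hT : IsGaussianTensor P T) (a : Tensor 𝕜 n) :
    P.map (fun ω => RCLike.re (inner 𝕜 (T ω) a)) =
      gaussianReal 0 (realPartVariance 𝕜 * ‖a‖₊ ^ 2) := by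
  have hmeas : ∀ i, Measurable (fun g : 𝕜 => RCLike.re (inner 𝕜 g (a i))) := fun i => by fun_prop
  have hlaw : ∀ i, HasLaw (fun ω => RCLike.re (inner 𝕜 (T ω i) (a i)))
      (gaussianReal 0 (realPartVariance 𝕜 * ‖a i‖₊ ^ 2)) P := fun i =>
    ⟨(hmeas i).comp_aemeasurable (hT.hasLaw i).aemeasurable, by
      rw [← map_re_inner_gaussianLaw (a i), ← (hT.hasLaw i).map_eq,
        AEMeasurable.map_map_of_aemeasurable (hmeas i).aemeasurable (hT.hasLaw i).aemeasurable]
      rfl⟩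
  have hsum := map_sum_gaussianReal hlaw (hT.indep.comp (fun i g => RCLike.re (inner 𝕜 g (a i)))
    hmeas)
  have h1 : (fun ω => RCLike.re (inner 𝕜 (T ω) a)) =
      ∑ i, fun ω => RCLike.re (inner 𝕜 (T ω i) (a i)) := by
    ext ω
    rw [PiLp.inner_apply, map_sum, Finset.sum_apply]
  rw [h1, hsum]
  congr 1
  rw [← Finset.mul_sum]
  congr 1
  ext
  simp [EuclideanSpace.norm_sq_eq]

/-- With `v` the variance, `c v = 3/8` makes `1 - 2cv = 1/4`, so the Gaussian integral is exactly 2.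
-/
theorem IsGaussianTensor.lintegral_exp_mul_re_inner_sq (hT : IsGaussianTensor P T)
    {a : Tensor 𝕜 n} (ha : ‖a‖ = 1) {c : ℝ} (hc : c * realPartVariance 𝕜 = 3 / 8) :
    ∫⁻ ω, ENNReal.ofReal (Real.exp (c * RCLike.re (inner 𝕜 (T ω) a) ^ 2)) ∂P = 2 := by
  have hmeas : AEMeasurable (fun ω => RCLike.re (inner 𝕜 (T ω) a)) P := by
    have := hT.aemeasurable
    fun_prop
  have ha' : ‖a‖₊ = 1 := by ext; simpa using ha
  have hv : realPartVariance 𝕜 ≠ 0 := by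
    unfold realPartVariance; split_ifs <;> simp
  have hmap := hT.map_re_inner a
  rw [ha', one_pow, mul_one] at hmap
  have := lintegral_map' (μ := P) (f := fun x : ℝ => ENNReal.ofReal (Real.exp (c * x ^ 2)))
    (by fun_prop) hmeas
  rw [← this, hmap, lintegral_exp_mul_sq_gaussianReal hv (by linarith),
    show 1 - 2 * c * realPartVariance 𝕜 = (1 / 2) ^ 2 by linarith, Real.sqrt_sq (by norm_num)]
  norm_num

theorem IsGaussianTensor.lintegral_exp_norm_inner_sq_le (hT : IsGaussianTensor P T)
    {a : Tensor 𝕜 n} (ha : ‖a‖ = 1) :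
    ∫⁻ ω, ENNReal.ofReal (Real.exp (3 / 8 * ‖inner 𝕜 (T ω) a‖ ^ 2)) ∂P ≤ 2 := by
  rcases RCLike.I_eq_zero_or_im_I_eq_one (K := 𝕜) with hI | hI
  · refine le_of_eq (Eq.trans (lintegral_congr fun ω => ?_)
      (hT.lintegral_exp_mul_re_inner_sq ha (c := 3 / 8) (by simp [realPartVariance, hI])))
    rw [RCLike.norm_sq_eq_def, RCLike.im_eq_zero hI, mul_zero, add_zero, sq]
  · have hI' : (RCLike.I : 𝕜) ≠ 0 := fun h => by simp [h] at hI
    have hc : (3 / 4 : ℝ) * realPartVariance 𝕜 = 3 / 8 := by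
      simp [realPartVariance, hI']; norm_num
    have h1 := hT.lintegral_exp_mul_re_inner_sq ha hc
    -- Rotating `a` by `I` turns the imaginary part into a real part, up to sign. AM-GM then splits
    -- `exp (3/8 (u² + w²))` into the mean of `exp (3/4 u²)` and `exp (3/4 w²)`, so independence of
    -- the two parts is not needed.
    have h2 := hT.lintegral_exp_mul_re_inner_sq (a := (RCLike.I : 𝕜) • a)
      (by rw [norm_smul, RCLike.norm_I_of_ne_zero hI', ha, one_mul]) hc
    have hmeas := hT.aemeasurable
    calc _ ≤ ∫⁻ ω, 2⁻¹ * (ENNReal.ofReal (Real.exp (3 / 4 * RCLike.re (inner 𝕜 (T ω) a) ^ 2)) +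
          ENNReal.ofReal
            (Real.exp (3 / 4 * RCLike.re (inner 𝕜 (T ω) ((RCLike.I : 𝕜) • a)) ^ 2))) ∂P := by
          refine lintegral_mono fun ω => ?_
          rw [← ENNReal.ofReal_add (by positivity) (by positivity),
            show (2⁻¹ : ENNReal) = ENNReal.ofReal 2⁻¹ by
              rw [ENNReal.ofReal_inv_of_pos (by norm_num)]; simp,
            ← ENNReal.ofReal_mul (by norm_num)]
          apply ENNReal.ofReal_le_ofReal
          have hz : RCLike.re (inner 𝕜 (T ω) ((RCLike.I : 𝕜) • a)) =
              -RCLike.im (inner 𝕜 (T ω) a) := by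
            rw [inner_smul_right, RCLike.I_mul_re]
          rw [hz, neg_sq, RCLike.norm_sq_eq_def]
          set u := RCLike.re (inner 𝕜 (T ω) a)
          set w := RCLike.im (inner 𝕜 (T ω) a)
          have e1 : ∀ t : ℝ, Real.exp (3 / 4 * t ^ 2) = Real.exp (3 / 8 * (t * t)) ^ 2 := by
            intro t
            rw [← Real.exp_nat_mul]
            congr 1
            push_cast
            ring
          rw [e1, e1, mul_add, Real.exp_add]
          nlinarith [sq_nonneg (Real.exp (3 / 8 * (u * u)) - Real.exp (3 / 8 * (w * w)))]
      _ = 2 := by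
          rw [lintegral_const_mul' _ _ (by simp), lintegral_add_left' (by fun_prop), h1, h2,
            ← two_mul, ← mul_assoc, ENNReal.inv_mul_cancel (by simp) (by simp), one_mul]

theorem lintegral_pi_prod_eq_pow {ι α : Type*} [Fintype ι] [MeasurableSpace α] {μ : Measure α}
    [IsProbabilityMeasure μ] {f : α → ℝ≥0∞} (hf : Measurable f) :
    ∫⁻ x : ι → α, ∏ i, f (x i) ∂Measure.pi (fun _ => μ) = (∫⁻ a, f a ∂μ) ^ Fintype.card ι := by
  rw [lintegral_prod_eq_prod_lintegral_of_indepFun Finset.univ (fun i (x : ι → α) => f (x i))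
    (iIndepFun_pi fun i => hf.aemeasurable) (fun i => by fun_prop)]
  have h : ∀ i, ∫⁻ x : ι → α, f (x i) ∂Measure.pi (fun _ => μ) = ∫⁻ a, f a ∂μ := fun i =>
    (measurePreserving_eval (fun _ => μ) i).lintegral_comp hf
  simp [h]

theorem IsGaussianTensor.lintegral_exp_neg_mul_norm_sq_le (hT : IsGaussianTensor P T) {s : ℝ}
    (hs : 0 ≤ s) :
    ∫⁻ ω, ENNReal.ofReal (Real.exp (-s * ‖T ω‖ ^ 2)) ∂P ≤
      ENNReal.ofReal ((1 + 2 * s) ^ (-((∏ j, n j : ℕ) : ℝ) / 2)) := by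
  have := hT.indep.isProbabilityMeasure
  have hf : Measurable fun g : 𝕜 => ENNReal.ofReal (Real.exp (-s * ‖g‖ ^ 2)) := by fun_prop
  have hlaw := (iIndepFun_iff_hasLaw_pi_pi hT.hasLaw).1 hT.indep
  have hprod : ∀ ω, ENNReal.ofReal (Real.exp (-s * ‖T ω‖ ^ 2)) =
      ∏ i, ENNReal.ofReal (Real.exp (-s * ‖T ω i‖ ^ 2)) := by
    intro ω
    rw [← ENNReal.ofReal_prod_of_nonneg (fun _ _ => by positivity), ← Real.exp_sum,
      EuclideanSpace.norm_sq_eq, Finset.mul_sum]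
  have h0 : 0 ≤ 1 + 2 * s := by linarith
  rw [lintegral_congr hprod, ← lintegral_map' (f := fun x : ((j : Fin d) → Fin (n j)) → 𝕜 =>
      ∏ i, ENNReal.ofReal (Real.exp (-s * ‖x i‖ ^ 2)))
      (Measurable.aemeasurable (by fun_prop)) hlaw.aemeasurable,
    hlaw.map_eq, lintegral_pi_prod_eq_pow hf]
  refine (pow_le_pow_left' (lintegral_exp_neg_mul_sq_gaussianLaw_le hs) _).trans_eq ?_
  rw [← ENNReal.ofReal_pow (by positivity), Fintype.card_pi, Real.sqrt_eq_rpow,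
    ← Real.rpow_neg h0, ← Real.rpow_natCast, ← Real.rpow_mul h0]
  simp only [Fintype.card_fin]
  congr 2
  ring

/-- At `y = 0` both sides are infinite. Hence a finite inverse moment also shows that a Gaussian
tensor is almost surely nonzero. -/
theorem lintegral_exp_neg_mul_Ioi_eq_inv {y : ℝ} (hy : 0 ≤ y) :
    ∫⁻ s in Set.Ioi (0 : ℝ), ENNReal.ofReal (Real.exp (-s * y)) = (ENNReal.ofReal y)⁻¹ := by
  rcases hy.eq_or_lt with rfl | hy
  · simp
  · have h := integral_exp_mul_Ioi (a := -y) (by linarith) 0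
    have hi : IntegrableOn (fun x : ℝ => Real.exp (-y * x)) (Set.Ioi 0) :=
      integrableOn_exp_mul_Ioi (by linarith) 0
    simp only [neg_mul, mul_comm y] at h hi
    simp only [neg_mul]
    rw [← ofReal_integral_eq_lintegral_ofReal hi
      (Filter.Eventually.of_forall fun x => by positivity), h, ← ENNReal.ofReal_inv_of_pos hy]
    simp

theorem lintegral_rpow_one_add_two_mul {N : ℝ} (hN : 2 < N) :
    ∫⁻ s in Set.Ioi (0 : ℝ), ENNReal.ofReal ((1 + 2 * s) ^ (-N / 2)) =
      ENNReal.ofReal (1 / (N - 2)) := by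
  let g : ℝ → ℝ := fun s => -(1 + 2 * s) ^ (-(N - 2) / 2) / (N - 2)
  have hderiv : ∀ s ∈ Set.Ici (0 : ℝ), HasDerivAt g ((1 + 2 * s) ^ (-N / 2)) s := by
    intro s hs
    have hs : (0 : ℝ) ≤ s := hs
    have h1 : HasDerivAt (fun s : ℝ => 1 + 2 * s) 2 s := by
      simpa using ((hasDerivAt_id s).const_mul 2).const_add 1
    have h2 := ((h1.rpow_const (p := -(N - 2) / 2) (Or.inl (by positivity))).neg).div_const
      (N - 2)
    convert! h2 using 1
    rw [show -(N - 2) / 2 - 1 = -N / 2 by ring]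
    have : N - 2 ≠ 0 := by linarith
    field_simp
  have hpos : ∀ s ∈ Set.Ioi (0 : ℝ), 0 ≤ (1 + 2 * s) ^ (-N / 2) := fun s hs => by
    have hs : (0 : ℝ) < s := hs
    positivity
  have hlim : Filter.Tendsto g Filter.atTop (nhds 0) := by
    have h1 : Filter.Tendsto (fun s : ℝ => 1 + 2 * s) Filter.atTop Filter.atTop :=
      Filter.tendsto_atTop_add_const_left _ _ (Filter.tendsto_id.const_mul_atTop (by norm_num))
    have h2 := (tendsto_rpow_neg_atTop (y := (N - 2) / 2) (by linarith)).comp h1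
    have h3 := (h2.neg).div_const (N - 2)
    simpa only [g, neg_div, Function.comp_def, neg_zero, zero_div] using h3
  rw [← ofReal_integral_eq_lintegral_ofReal (integrableOn_Ioi_deriv_of_nonneg' hderiv hpos hlim)
    ((ae_restrict_iff' measurableSet_Ioi).2 (Filter.Eventually.of_forall hpos)),
    integral_Ioi_of_hasDerivAt_of_nonneg' hderiv hpos hlim]
  congr 1
  simp [g, neg_div]

theorem IsGaussianTensor.lintegral_inv_norm_sq_le (hT : IsGaussianTensor P T) [SFinite P]
    (hN : 2 < ∏ j, n j) :
    ∫⁻ ω, (ENNReal.ofReal (‖T ω‖ ^ 2))⁻¹ ∂P ≤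
      ENNReal.ofReal (1 / ((∏ j, n j : ℕ) - 2)) := by
  have hmeas := hT.aemeasurable
  calc _ = ∫⁻ ω, (∫⁻ s in Set.Ioi (0 : ℝ), ENNReal.ofReal (Real.exp (-s * ‖T ω‖ ^ 2))) ∂P := by
        simp_rw [lintegral_exp_neg_mul_Ioi_eq_inv (sq_nonneg _)]
    _ = ∫⁻ s in Set.Ioi (0 : ℝ), ∫⁻ ω, ENNReal.ofReal (Real.exp (-s * ‖T ω‖ ^ 2)) ∂P := by
        rw [lintegral_lintegral_swap]
        have h1 : AEMeasurable (fun p : Ω × ℝ => T p.1) (P.prod (volume.restrict (Set.Ioi 0))) :=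
          hmeas.comp_fst
        have h2 : AEMeasurable (fun p : Ω × ℝ => -p.2 * ‖T p.1‖ ^ 2)
          (P.prod (volume.restrict (Set.Ioi 0))) := by fun_prop
        exact h2.exp.ennreal_ofReal
    _ ≤ ∫⁻ s in Set.Ioi (0 : ℝ),
          ENNReal.ofReal ((1 + 2 * s) ^ (-((∏ j, n j : ℕ) : ℝ) / 2)) :=
        setLIntegral_mono (by fun_prop) fun s hs =>
          hT.lintegral_exp_neg_mul_norm_sq_le (le_of_lt hs)
    _ = _ := lintegral_rpow_one_add_two_mul (by exact_mod_cast hN)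

end GaussianTensor

theorem integrable_and_integral_le_of_lintegral_le {Ω : Type*} [MeasurableSpace Ω]
    {P : Measure Ω} {f : Ω → ℝ} (hf : AEStronglyMeasurable f P) (h0 : ∀ ω, 0 ≤ f ω) {C : ℝ}
    (hC : 0 ≤ C) (h : ∫⁻ ω, ENNReal.ofReal (f ω) ∂P ≤ ENNReal.ofReal C) :
    Integrable f P ∧ ∫ ω, f ω ∂P ≤ C := by
  refine ⟨⟨hf, ?_⟩, ?_⟩
  · rw [hasFiniteIntegral_iff_ofReal (Filter.Eventually.of_forall h0)]
    exact h.trans_lt ENNReal.ofReal_lt_top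
  · rw [integral_eq_lintegral_of_nonneg_ae (Filter.Eventually.of_forall h0) hf]
    exact ENNReal.toReal_le_of_le_ofReal hC h

/-! ### Moment bounds, the mean ratio, and passage to the minimum. -/

section GaussianTensor

variable {𝕜 : Type*} [RCLike 𝕜] {d : ℕ} {n : Fin d → ℕ} {Ω : Type*} [MeasurableSpace Ω]
  {P : Measure Ω} {T : Ω → Tensor 𝕜 n}

theorem finrank_real_euclideanSpace_le (m : ℕ) :
    Module.finrank ℝ (EuclideanSpace 𝕜 (Fin m)) ≤ 2 * m := by
  rw [(WithLp.linearEquiv 2 ℝ (Fin m → 𝕜)).finrank_eq, Module.finrank_pi_fintype]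
  simpa [mul_comm] using Nat.mul_le_mul_left m (RCLike.finrank_le_two 𝕜)

/-- The maximum over a product of nets of total size at most `B` controls the second moment. -/
theorem IsGaussianTensor.integral_specNorm_sq_le [IsProbabilityMeasure P]
    (hT : IsGaussianTensor P T) (hd : 0 < d) (hn : ∀ j, 2 ≤ n j) :
    Integrable (fun ω => specNorm (T ω) ^ 2) P ∧
      ∫ ω, specNorm (T ω) ^ 2 ∂P ≤
        32 / 3 * Real.log (2 * (1 + 4 * d) ^ (2 * ∑ j, n j)) := by
  have hd' : (0 : ℝ) < d := by exact_mod_cast hd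
  choose s hs hcard hnet using fun j => exists_finset_sphere_net
    (E := EuclideanSpace 𝕜 (Fin (n j))) (ε := 1 / (2 * d)) (by positivity)
  let F := Fintype.piFinset s
  have hmax := exists_net_specNorm_le hd hn s hs hnet
  set B : ℝ := (1 + 4 * d) ^ (2 * ∑ j, n j) with hB
  have hB0 : 0 < B := by positivity
  have hF : (F.card : ℝ) ≤ B := by
    rw [Fintype.card_piFinset, hB, Finset.mul_sum, ← Finset.prod_pow_eq_pow_sum]
    push_cast
    refine Finset.prod_le_prod (fun _ _ => by positivity) fun j _ => (hcard j).trans ?_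
    rw [show 1 + 2 / (1 / (2 * d)) = 1 + 4 * (d : ℝ) by field_simp; ring]
    exact pow_le_pow_right₀ (by linarith) (finrank_real_euclideanSpace_le _)
  have hmeas := hT.aemeasurable
  have hexp : ∀ y ∈ F, Integrable
      (fun ω => Real.exp (3 / 8 * ‖inner 𝕜 (T ω) (pureTensor y)‖ ^ 2)) P ∧
      ∫ ω, Real.exp (3 / 8 * ‖inner 𝕜 (T ω) (pureTensor y)‖ ^ 2) ∂P ≤ 2 := by
    intro y hy
    refine integrable_and_integral_le_of_lintegral_le ?_ (fun _ => by positivity) (by norm_num) ?_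
    · exact AEMeasurable.aestronglyMeasurable (by fun_prop)
    · rw [ENNReal.ofReal_ofNat]
      refine hT.lintegral_exp_norm_inner_sq_le ?_
      rw [norm_pureTensor]
      exact Finset.prod_eq_one fun j _ => hs j _ (Fintype.mem_piFinset.1 hy j)
  set c := Real.log (2 * B) with hc
  -- With `u = 3/8 |⟨T, y⟩|²`, the net bound reads `specNorm² ≤ 4 |⟨T, y⟩|² = 32/3 u`. The tangent
  -- inequality `u ≤ c - 1 + exp (u - c)` at `c = log (2B)` is then used, with the exponential at
  -- the good `y` bounded by the sum over the net. That sum has mean at most `2B`, so its normalized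
  -- mean cancels the `-1`.
  let g : Ω → ℝ := fun ω => 32 / 3 * (c - 1 + (2 * B)⁻¹ *
    ∑ y ∈ F, Real.exp (3 / 8 * ‖inner 𝕜 (T ω) (pureTensor y)‖ ^ 2))
  have hsumint : Integrable (fun ω => ∑ y ∈ F,
      Real.exp (3 / 8 * ‖inner 𝕜 (T ω) (pureTensor y)‖ ^ 2)) P :=
    integrable_finsetSum _ fun y hy => (hexp y hy).1
  have hg : Integrable g P := ((integrable_const _).add (hsumint.const_mul _)).const_mul _
  have hle : ∀ ω, specNorm (T ω) ^ 2 ≤ g ω := by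
    intro ω
    obtain ⟨y, hy, h⟩ := hmax (T ω)
    have h1 := pow_le_pow_left₀ (specNorm_nonneg _) h 2
    set u := 3 / 8 * ‖inner 𝕜 (T ω) (pureTensor y)‖ ^ 2 with hu
    have h2 : Real.exp u ≤ ∑ y ∈ F, Real.exp (3 / 8 * ‖inner 𝕜 (T ω) (pureTensor y)‖ ^ 2) :=
      Finset.single_le_sum
        (f := fun y => Real.exp (3 / 8 * ‖inner 𝕜 (T ω) (pureTensor y)‖ ^ 2))
        (fun _ _ => by positivity) hy
    have h3 : Real.exp (u - c) = (2 * B)⁻¹ * Real.exp u := by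
      rw [Real.exp_sub, hc, Real.exp_log (by positivity), inv_mul_eq_div]
    have h4 := Real.add_one_le_exp (u - c)
    have h5 : (2 * B)⁻¹ * Real.exp u ≤ (2 * B)⁻¹ *
      ∑ y ∈ F, Real.exp (3 / 8 * ‖inner 𝕜 (T ω) (pureTensor y)‖ ^ 2) := by gcongr
    simp only [g]
    nlinarith
  have hint : Integrable (fun ω => specNorm (T ω) ^ 2) P := by
    refine hg.mono' ?_ (Filter.Eventually.of_forall fun ω => ?_)
    · exact (((continuous_specNorm hn).measurable.comp_aemeasurable hmeas).pow_const 2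
        ).aestronglyMeasurable
    · rw [Real.norm_of_nonneg (sq_nonneg _)]
      exact hle ω
  refine ⟨hint, (integral_mono hint hg hle).trans ?_⟩
  have hsum : ∫ ω, ∑ y ∈ F, Real.exp (3 / 8 * ‖inner 𝕜 (T ω) (pureTensor y)‖ ^ 2) ∂P ≤ 2 * B := by
    rw [integral_finsetSum _ fun y hy => (hexp y hy).1]
    calc _ ≤ ∑ y ∈ F, (2 : ℝ) := Finset.sum_le_sum fun y hy => (hexp y hy).2
      _ = 2 * F.card := by simp [mul_comm]
      _ ≤ 2 * B := by linarith
  simp only [g]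
  rw [integral_const_mul, integral_add (integrable_const _) (hsumint.const_mul _),
    integral_const_mul, integral_const, probReal_univ, one_smul]
  have := mul_le_mul_of_nonneg_left hsum (by positivity : 0 ≤ (2 * B)⁻¹)
  rw [inv_mul_cancel₀ (by positivity)] at this
  linarith

theorem IsGaussianTensor.integral_inv_norm_sq_le [SFinite P] (hT : IsGaussianTensor P T)
    (hN : 2 < ∏ j, n j) :
    Integrable (fun ω => (‖T ω‖ ^ 2)⁻¹) P ∧
      ∫ ω, (‖T ω‖ ^ 2)⁻¹ ∂P ≤ 1 / ((∏ j, n j : ℕ) - 2) := by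
  have hmeas := hT.aemeasurable
  have hN' : (2 : ℝ) < (∏ j, n j : ℕ) := by exact_mod_cast hN
  refine integrable_and_integral_le_of_lintegral_le
    (AEMeasurable.aestronglyMeasurable (by fun_prop)) (fun _ => by positivity)
    (one_div_nonneg.2 (by linarith))
    ((lintegral_mono fun ω => ?_).trans (hT.lintegral_inv_norm_sq_le hN))
  rcases (norm_nonneg (T ω)).eq_or_lt with h | h
  · simp [← h]
  · rw [ENNReal.ofReal_inv_of_pos (by positivity)]

theorem IsGaussianTensor.ae_ne_zero [SFinite P] (hT : IsGaussianTensor P T)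
    (hN : 2 < ∏ j, n j) : ∀ᵐ ω ∂P, T ω ≠ 0 := by
  have hmeas := hT.aemeasurable
  have h := ae_lt_top' (f := fun ω => (ENNReal.ofReal (‖T ω‖ ^ 2))⁻¹) (by fun_prop)
    ((hT.lintegral_inv_norm_sq_le hN).trans_lt ENNReal.ofReal_lt_top).ne
  filter_upwards [h] with ω hω h0
  simp [h0] at hω

theorem IsGaussianTensor.integrable_ratio [IsFiniteMeasure P] (hT : IsGaussianTensor P T)
    (hn : ∀ j, 2 ≤ n j) : Integrable (fun ω => specNorm (T ω) / ‖T ω‖) P := by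
  have hmeas := hT.aemeasurable
  have h1 := (continuous_specNorm hn).measurable.comp_aemeasurable hmeas
  refine Integrable.of_bound (h1.div hmeas.norm).aestronglyMeasurable 1
    (Filter.Eventually.of_forall fun ω => ?_)
  have h0 := specNorm_nonneg (T ω)
  rw [Real.norm_of_nonneg (by positivity)]
  exact div_le_one_of_le₀ (specNorm_le_norm hn _) (norm_nonneg _)

theorem IsGaussianTensor.integral_ratio_le [IsProbabilityMeasure P]
    (hT : IsGaussianTensor P T) (hd : 0 < d) (hn : ∀ j, 2 ≤ n j) (hN : 2 < ∏ j, n j) {Q : ℝ}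
    (hQ : 0 < Q)
    (h : 32 / 3 * Real.log (2 * (1 + 4 * d) ^ (2 * ∑ j, n j)) * (1 / ((∏ j, n j : ℕ) - 2)) ≤
      Q ^ 2) :
    ∫ ω, specNorm (T ω) / ‖T ω‖ ∂P ≤ Q := by
  obtain ⟨hA, hA'⟩ := hT.integral_specNorm_sq_le hd hn
  obtain ⟨hB, hB'⟩ := hT.integral_inv_norm_sq_le hN
  set A := 32 / 3 * Real.log (2 * (1 + 4 * d) ^ (2 * ∑ j, n j))
  set B : ℝ := 1 / ((∏ j, n j : ℕ) - 2)
  have hApos : 0 < A := by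
    refine mul_pos (by norm_num) (Real.log_pos ?_)
    have : (1 : ℝ) ≤ (1 + 4 * d) ^ (2 * ∑ j, n j) :=
      one_le_pow₀ (by linarith [d.cast_nonneg (α := ℝ)])
    linarith
  have hint := ((hA.const_mul (Q / A)).add (hB.const_mul (A / Q))).div_const 2
  refine (integral_mono (hT.integrable_ratio hn) hint fun ω => ?_).trans ?_
  · have h1 := two_mul_le_add_sq (Real.sqrt (Q / A) * specNorm (T ω))
      (Real.sqrt (A / Q) * ‖T ω‖⁻¹)
    rw [mul_pow, mul_pow, Real.sq_sqrt (by positivity), Real.sq_sqrt (by positivity), inv_pow,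
      show 2 * (√(Q / A) * specNorm (T ω)) * (√(A / Q) * ‖T ω‖⁻¹) =
        2 * (√(Q / A) * √(A / Q)) * (specNorm (T ω) * ‖T ω‖⁻¹) by ring,
      ← Real.sqrt_mul (by positivity), div_mul_div_cancel₀ hApos.ne', div_self hQ.ne',
      Real.sqrt_one] at h1
    simp only [Pi.add_apply, div_eq_mul_inv (specNorm (T ω))]
    linarith
  · simp only [Pi.add_apply]
    rw [integral_div, integral_add (hA.const_mul _) (hB.const_mul _), integral_const_mul,
      integral_const_mul]
    have h1 : Q / A * ∫ ω, specNorm (T ω) ^ 2 ∂P ≤ Q := by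
      calc _ ≤ Q / A * A := by gcongr
        _ = Q := by field_simp
    have h2 : A / Q * ∫ ω, (‖T ω‖ ^ 2)⁻¹ ∂P ≤ Q := by
      calc _ ≤ A / Q * B := by gcongr
        _ = A * B / Q := by ring
        _ ≤ Q := by rw [div_le_iff₀ hQ]; linarith
    linarith

theorem isGaussianTensor_pi :
    IsGaussianTensor (Measure.pi fun _ : (j : Fin d) → Fin (n j) => gaussianLaw 𝕜)
      (fun x => (WithLp.toLp 2 x : Tensor 𝕜 n)) where
  hasLaw i := ⟨(measurable_pi_apply i).aemeasurable,
    (measurePreserving_eval (fun _ => gaussianLaw 𝕜) i).map_eq⟩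
  indep := iIndepFun_pi (X := fun _ => id) fun _ => aemeasurable_id

theorem approxRatio_le_of_integral_ratio_le (hn : ∀ j, 2 ≤ n j) (hN : 2 < ∏ j, n j) {Q : ℝ}
    (h : ∫ x, specNorm (WithLp.toLp 2 x : Tensor 𝕜 n) / ‖(WithLp.toLp 2 x : Tensor 𝕜 n)‖
      ∂(Measure.pi fun _ : (j : Fin d) → Fin (n j) => gaussianLaw 𝕜) ≤ Q) :
    approxRatio 𝕜 n ≤ Q := by
  have hT := isGaussianTensor_pi (𝕜 := 𝕜) (n := n)
  refine le_trans ?_ h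
  have h1 := integral_mono_ae (integrable_const (approxRatio 𝕜 n)) (hT.integrable_ratio hn)
    (by
      filter_upwards [hT.ae_ne_zero hN] with x hx
      exact (isLeast_approxRatio hn).2 ⟨_, hx, rfl⟩)
  simpa using h1

end GaussianTensor

/-! ### Numerical constants. -/

section Numeric

theorem log_two_mul_pow_le {d m D : ℕ} (hd : 3 ≤ d) (hm : 2 ≤ m) (hD : D ≤ d * m) :
    Real.log (2 * (1 + 4 * d) ^ (2 * D)) ≤ d * m * (2 * Real.log d + 10 / 3) := by
  have hd' : (3 : ℝ) ≤ d := by exact_mod_cast hd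
  have hm' : (2 : ℝ) ≤ m := by exact_mod_cast hm
  have hD' : (D : ℝ) ≤ d * m := by exact_mod_cast hD
  have he := Real.exp_one_gt_d9
  -- For `d ≥ 3`, `1 + 4d ≤ (8/5) e d`, and `log (8/5) ≤ 3/5`.
  have hlog : Real.log (1 + 4 * d) ≤ Real.log d + 8 / 5 := by
    have h1 : Real.log (1 + 4 * d) ≤ Real.log (d * (Real.exp 1 * (8 / 5))) :=
      Real.log_le_log (by positivity) (by nlinarith)
    rw [Real.log_mul (by positivity) (by positivity), Real.log_mul (by positivity) (by norm_num),
      Real.log_exp] at h1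
    have := Real.log_le_sub_one_of_pos (show (0 : ℝ) < 8 / 5 by norm_num)
    linarith
  have hlog0 : 0 ≤ Real.log (1 + 4 * d) := Real.log_nonneg (by linarith)
  have h2 := Real.log_two_lt_d9
  have hdm : 6 ≤ (d : ℝ) * m := by nlinarith
  rw [Real.log_mul (by norm_num) (by positivity), Real.log_pow]
  push_cast
  calc _ ≤ (d * m) * (2 / 15) + 2 * (d * m) * (Real.log d + 8 / 5) := by
        gcongr
        linarith
    _ = _ := by ring

theorem second_moment_bound_le {d : ℕ} (hd : 3 ≤ d) {n : Fin d → ℕ} (hn : ∀ j, 2 ≤ n j) :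
    32 / 3 * Real.log (2 * (1 + 4 * d) ^ (2 * ∑ j, n j)) * (1 / ((∏ j, n j : ℕ) - 2)) ≤
      (2 * √(3 * Real.exp 1) * √(1 + 2 / Real.log d) *
        (√(d * Real.log d) / √(minCoprod n : ℝ))) ^ 2 := by
  obtain ⟨m, hm, hnm, hM⟩ := exists_minCoprod_mul_eq (by omega) hn
  have hD : ∑ j, n j ≤ d * m := by
    simpa using Finset.sum_le_sum fun j (_ : j ∈ Finset.univ) => hnm j
  have hN : 8 ≤ ∏ j, n j :=
    calc 8 = 2 ^ 3 := by norm_num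
      _ ≤ 2 ^ d := Nat.pow_le_pow_right (by norm_num) hd
      _ ≤ ∏ j, n j := by simpa using Finset.prod_le_prod' fun j (_ : j ∈ Finset.univ) => hn j
  have hlog := log_two_mul_pow_le hd hm hD
  have hd' : (3 : ℝ) ≤ d := by exact_mod_cast hd
  have hm' : (2 : ℝ) ≤ m := by exact_mod_cast hm
  have hL : 0 < Real.log d := Real.log_pos (by linarith)
  have hM0 : (0 : ℝ) < minCoprod n := by
    have : 0 < minCoprod n := Nat.pos_of_ne_zero fun h => by simp [h] at hM; omega
    exact_mod_cast this
  have hMm : ((∏ j, n j : ℕ) : ℝ) = minCoprod n * m := by exact_mod_cast hM.symm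
  have hN' : (8 : ℝ) ≤ (∏ j, n j : ℕ) := by exact_mod_cast hN
  have he := Real.exp_one_gt_d9
  rw [hMm] at hN' ⊢
  -- This is where `N ≥ 8` enters: then `N - 2 ≥ 3N/4`.
  have hinv : 1 / ((minCoprod n : ℝ) * m - 2) ≤ 4 / (3 * (minCoprod n * m)) := by
    rw [div_le_div_iff₀ (by linarith) (by positivity)]
    linarith
  calc _ ≤ 32 / 3 * (d * m * (2 * Real.log d + 10 / 3)) * (4 / (3 * (minCoprod n * m))) := by
        gcongr
        exact one_div_nonneg.2 (by linarith)
    _ = 256 / 9 * (Real.log d + 5 / 3) * (d / minCoprod n) := by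
        field_simp
        ring
    -- The slack is `256/9 < 12e` and `5/3 < 2`; the right side is the expanded square of the
    -- target.
    _ ≤ 12 * Real.exp 1 * (Real.log d + 2) * (d / minCoprod n) := by
        gcongr
        · linarith
        · norm_num
    _ = _ := by
        rw [mul_pow, mul_pow, mul_pow, div_pow, Real.sq_sqrt (by positivity),
          Real.sq_sqrt (by positivity), Real.sq_sqrt (by positivity), Real.sq_sqrt hM0.le]
        field_simp
        ring

end Numeric

end BestRankOne

/-! ### The main theorem. -/

theorem theorem1p1 {𝕜 : Type*} [RCLike 𝕜] {d : ℕ} (hd : 3 ≤ d) (n : Fin d → ℕ)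
    (hn : ∀ j, 2 ≤ n j) :
    -- the maximum and the minimum in the definitions are attained
    (∀ T : BestRankOne.Tensor 𝕜 n,
      IsGreatest (BestRankOne.spectralValues T) (BestRankOne.specNorm T)) ∧
    IsLeast (BestRankOne.normRatios 𝕜 n) (BestRankOne.approxRatio 𝕜 n) ∧
    -- the two bounds on the ratio
    1 / √(BestRankOne.minCoprod n : ℝ) ≤ BestRankOne.approxRatio 𝕜 n ∧
    BestRankOne.approxRatio 𝕜 n ≤
      10 * √(d * Real.log d) / √(BestRankOne.minCoprod n : ℝ) ∧
    -- the sharper upper bound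
    BestRankOne.approxRatio 𝕜 n ≤
      2 * √(3 * Real.exp 1) * √(1 + 2 / Real.log d) *
        (√(d * Real.log d) / √(BestRankOne.minCoprod n : ℝ)) ∧
    -- the bound on the expectation for Gaussian tensors
    (∀ {Ω : Type*} [MeasurableSpace Ω] (P : MeasureTheory.Measure Ω)
        [MeasureTheory.IsProbabilityMeasure P] (T : Ω → BestRankOne.Tensor 𝕜 n),
      BestRankOne.IsGaussianTensor P T →
        MeasureTheory.Integrable (fun ω => BestRankOne.specNorm (T ω) / ‖T ω‖) P ∧
        ∫ ω, BestRankOne.specNorm (T ω) / ‖T ω‖ ∂P ≤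
          9 * (1 + 1 / Real.log d + 2 / (d + ∑ j, (n j : ℝ))) *
            (√(d * Real.log d) / √(BestRankOne.minCoprod n : ℝ))) := by
  have hd0 : 0 < d := by omega
  have hd' : (3 : ℝ) ≤ d := by exact_mod_cast hd
  have he := Real.exp_one_lt_d9
  have hL : 1 ≤ Real.log d := by
    rw [Real.le_log_iff_exp_le (by positivity)]
    linarith
  obtain ⟨m, hm, -, hM⟩ := BestRankOne.exists_minCoprod_mul_eq hd0 hn
  have hN : 2 < ∏ j, n j :=
    calc 2 < 2 ^ 3 := by norm_num
      _ ≤ 2 ^ d := Nat.pow_le_pow_right (by norm_num) hd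
      _ ≤ ∏ j, n j := by simpa using Finset.prod_le_prod' fun j (_ : j ∈ Finset.univ) => hn j
  have hM0 : (0 : ℝ) < BestRankOne.minCoprod n := by
    have : 0 < BestRankOne.minCoprod n := Nat.pos_of_ne_zero fun h => by simp [h] at hM; omega
    exact_mod_cast this
  have hbound := BestRankOne.second_moment_bound_le hd hn
  have hQ : 0 < 2 * √(3 * Real.exp 1) * √(1 + 2 / Real.log d) *
        (√(d * Real.log d) / √(BestRankOne.minCoprod n : ℝ)) := by positivity
  have hsharp := BestRankOne.approxRatio_le_of_integral_ratio_le (𝕜 := 𝕜) hn hN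
    (BestRankOne.isGaussianTensor_pi.integral_ratio_le hd0 hn hN hQ hbound)
  refine ⟨BestRankOne.isGreatest_specNorm hn, BestRankOne.isLeast_approxRatio hn,
    BestRankOne.one_div_sqrt_minCoprod_le hd0 hn, hsharp.trans ?_, hsharp, ?_⟩
  · rw [mul_div_assoc]
    gcongr
    rw [mul_assoc, ← Real.sqrt_mul (by positivity)]
    have h1 : 2 / Real.log d ≤ 2 := div_le_self (by norm_num) hL
    -- Since `log d ≥ 1`, the radicand is at most `9e < 25`.
    have h2 : √(3 * Real.exp 1 * (1 + 2 / Real.log d)) ≤ 5 := by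
      rw [Real.sqrt_le_iff]
      refine ⟨by norm_num, ?_⟩
      nlinarith [Real.exp_pos 1]
    linarith
  · intro Ω _ P _ T hT
    refine ⟨hT.integrable_ratio hn, (hT.integral_ratio_le hd0 hn hN hQ hbound).trans ?_⟩
    have h1 : 2 * √(3 * Real.exp 1) ≤ 9 := by
      have : √(3 * Real.exp 1) ≤ 9 / 2 := by
        rw [Real.sqrt_le_iff]
        constructor <;> linarith
      linarith
    have h2 : √(1 + 2 / Real.log d) ≤ 1 + 1 / Real.log d := by
      rw [Real.sqrt_le_iff]
      refine ⟨by positivity, ?_⟩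
      have : (1 + 1 / Real.log d) ^ 2 = 1 + 2 / Real.log d + (1 / Real.log d) ^ 2 := by ring
      have := sq_nonneg (1 / Real.log d)
      linarith
    -- The sharp bound already gives `9 (1 + 1 / log d)`; this last term is only a nonnegative
    -- surplus.
    have h3 : 0 ≤ 2 / (d + ∑ j, (n j : ℝ)) := by positivity
    refine mul_le_mul_of_nonneg_right ?_ (by positivity)
    exact mul_le_mul h1 (by linarith) (by positivity) (by norm_num)
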